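/- There exist absolute constants $c,c_0,c_1,c_2>0$ such that for every $\eta\in(0,1]$ there exist a connected undirected graph $\mathcal G$ on agents $\{1,\dots,m\}$ and a gossip matrix $W\in\mathbb R^{m\times m}$ over $\mathcal G$ (symmetric positive semidefinite, $W_{ij}\neq 0$ only if $i=j$ or $\{i,j\}$ is an edge, and $\mathrm{null}(W)=\mathrm{span}\{\mathbf 1\}$) whose eigenvalues $0=\lambda_1\le\lambda_2\le\dots\le\lambda_m$ satisfy $\lambda_2/\lambda_m=\eta$, with the following property. For all $L_f,R,\tau_c>0$, all $\epsilon$ with $0<\epsilon\le c_0L_fR^2$, and every dimension $d$ with $\sqrt{L_fR^2/\epsilon}\le (d-1)/2$, there are local cost functions $f_1,\dots,f_m:\mathbb R^d\to\mathbb R$ (the hard instance), each convex and $L_f$-smooth, such that $F=\sum_{i=1}^m f_i$ has a minimizer $x^\star$ with the following properties. Write $\mathbf x^0=\mathbf 0\in\mathbb R^{m\times d}$, $\mathbf x^\star=\mathbf 1(x^\star)^\top$, $f(\mathbf x)=\sum_i f_i(x_i)$, where $x_i$ is the $i$-th row of $\mathbf x$, and let $\|\cdot\|$ be the Frobenius norm.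 (i) $\|\mathbf x^0-\mathbf x^\star\|=R$, and $$c_1\sqrt{\frac{L_fR^2}{\epsilon}}\;\le\;\frac{R\,\|\nabla f(\mathbf x^\star)\|}{\epsilon}\;\le\; c_2\sqrt{\frac{L_fR^2}{\epsilon}}.$$ (ii) Let $(\mathbf x^{(t)})_{t\ge 0}$ be generated by any distributed first-order method over $\mathcal G$ in which a gradient evaluation takes time $1$ and a communication takes time $\tau_c$; that is, $\mathbf x^{(0)}=\mathbf 0$ and, for all $t\ge0$ and all agents $i$ (with set of neighbors $\mathcal N_i$), $$x_i^{(t)}\in \mathrm{span}\{x_j^{(s)}: j\in\mathcal N_i,\ 0\le s<t-\tau_c\}+\mathrm{span}\{x_i^{(s)},\nabla f_i(x_i^{(s)}): 0\le s<t-1\}.$$ If at a time $t\ge 0$ the function-error metric satisfies $\max_i\big(F(x_i^{(t)})-\min_{x\in\mathbb R^d} F(x)\big)\le\epsilon$, then $$t\;\ge\; c\left(1+\frac{\tau_c}{\sqrt\eta}\right)\left(\sqrt{\frac{L_fR^2}{\epsilon}}+\frac{R\,\|\nabla f(\mathbf x^\star)\|}{\epsilon}\right).$$ On the same instance, the same lower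 bound on $t$ holds if instead the Bregman distance satisfies $f(\mathbf x^{(t)})-f(\mathbf x^\star)-\langle\nabla f(\mathbf x^\star),\mathbf x^{(t)}-\mathbf x^\star\rangle\le\epsilon$. Thus the time needed to drive the function-error metric below $\epsilon$ is $\Omega\big((1+\tau_c/\sqrt\eta)(\sqrt{L_fR^2/\epsilon}+R\|\nabla f(\mathbf x^\star)\|/\epsilon)\big)$; by (i) this is equivalent to $\Omega\big((1+\tau_c/\sqrt\eta)\sqrt{L_fR^2/\epsilon}\big)$. -/

import Mathlib

namespace DecOpt

/-- The symmetric matrix `W` is induced by the graph `G`: off-diagonal entries are supported on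
edges. -/
def InducedBy {m : ℕ} (G : SimpleGraph (Fin m)) (W : Matrix (Fin m) (Fin m) ℝ) : Prop :=
  W.IsSymm ∧ ∀ i j, W i j ≠ 0 → i = j ∨ G.Adj i j

/-- Gossip matrices over `G`: induced by `G`, positive semidefinite, with null space `span {𝟏}`. -/
structure IsGossipMatrix {m : ℕ} (G : SimpleGraph (Fin m)) (W : Matrix (Fin m) (Fin m) ℝ) :
    Prop where
  induced : InducedBy G W
  posSemidef : W.PosSemidef
  null : LinearMap.ker W.mulVecLin = Submodule.span ℝ {fun _ => (1 : ℝ)}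

/-- `W` has eigenvalues `lam 0 ≤ lam 1 ≤ … ≤ lam (m - 1)`, listed with multiplicity, and the ratio
of the second smallest to the largest one is `η`. -/
def HasEigengap {m : ℕ} (W : Matrix (Fin m) (Fin m) ℝ) (η : ℝ) : Prop :=
  ∃ lam : Fin m → ℝ, Monotone lam ∧ W.charpoly.roots = Finset.univ.val.map lam ∧
    ∃ h : 2 ≤ m, lam ⟨1, by omega⟩ / lam ⟨m - 1, by omega⟩ = η

/-- `g` is convex and `L`-smooth: differentiable with an `L`-Lipschitz gradient. -/
structure IsConvexSmooth {d : ℕ} (L : ℝ) (g : EuclideanSpace ℝ (Fin d) → ℝ) : Prop where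
  convex : ConvexOn ℝ Set.univ g
  differentiable : Differentiable ℝ g
  lipschitz : ∀ x y, ‖gradient g x - gradient g y‖ ≤ L * ‖x - y‖

/-- The objective `F(x) = ∑ᵢ fᵢ(x)`. -/
noncomputable def objective {m d : ℕ} (f : Fin m → EuclideanSpace ℝ (Fin d) → ℝ)
    (x : EuclideanSpace ℝ (Fin d)) : ℝ :=
  ∑ i, f i x

/-- The Frobenius norm of the stacked matrix with rows `v i`. -/
noncomputable def frobNorm {m d : ℕ} (v : Fin m → EuclideanSpace ℝ (Fin d)) : ℝ :=
  Real.sqrt (∑ i, ‖v i‖ ^ 2)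

/-- The function-error metric `maxᵢ (F(xᵢ) - min F)`. -/
noncomputable def fem {m d : ℕ} (f : Fin m → EuclideanSpace ℝ (Fin d) → ℝ)
    (x : Fin m → EuclideanSpace ℝ (Fin d)) : ℝ :=
  ⨆ i, (objective f (x i) - ⨅ y, objective f y)

/-- The Bregman distance `G(𝐱, 𝐱⋆) = f(𝐱) - f(𝐱⋆) - ⟨∇f(𝐱⋆), 𝐱 - 𝐱⋆⟩` for the separable function
`f(𝐱) = ∑ᵢ fᵢ(xᵢ)`, at the consensus point `𝐱⋆` all of whose rows are `xstar`. -/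
noncomputable def bregman {m d : ℕ} (f : Fin m → EuclideanSpace ℝ (Fin d) → ℝ)
    (xstar : EuclideanSpace ℝ (Fin d)) (x : Fin m → EuclideanSpace ℝ (Fin d)) : ℝ :=
  ∑ i, (f i (x i) - f i xstar - inner ℝ (gradient (f i) xstar) (x i - xstar))

/-- The trajectory `x` (agent `i` holds `x t i` at time `t ≥ 0`) is generated by a distributed
first-order method over `G`: it starts at zero; a communication with a neighbor takes time `τ`
and a local gradient computation takes unit time. -/
structure IsFirstOrderTrajectory {m d : ℕ} (G : SimpleGraph (Fin m)) (τ : ℝ)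
    (f : Fin m → EuclideanSpace ℝ (Fin d) → ℝ)
    (x : ℝ → Fin m → EuclideanSpace ℝ (Fin d)) : Prop where
  init : ∀ i, x 0 i = 0
  step : ∀ t, 0 ≤ t → ∀ i,
    x t i ∈
      Submodule.span ℝ {v | ∃ j s, G.Adj i j ∧ 0 ≤ s ∧ s < t - τ ∧ v = x s j} ⊔
      Submodule.span ℝ
        {v | ∃ s, 0 ≤ s ∧ s < t - 1 ∧ (v = x s i ∨ v = gradient (f i) (x s i))}

end DecOpt

/-! The hard instance is a Nesterov-type chain split between the two ends of a path-like network.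

Network: the path with edge weights `(i + 1) (m - 1 - i)` has a Laplacian with spectrum `k (k + 1)`,
read off in the binomial basis. A quadratic polynomial in it has two free coefficients, enough to
make the eigenvalue ratio exactly `η`, and its support joins path vertices at distance at most `2`.
Taking `m` of order `1 / √η` keeps the two ends about `1 / √η` hops apart
(`exists_isGossipMatrix_hasEigengap`).

Costs: link `j` of the chain penalizes the difference of coordinates `j` and `j - 1`. The first `k`
agents hold the even links, the last `k` the odd ones, with `k` about `m / 4`. A state supported on
the first `K` coordinates gains a new coordinate only through link `K`, so information must cross
the network once per coordinate. A potential argument (`IsFirstOrderTrajectory.mem_of_le`) shows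
that each coordinate costs time `1 + τ D`, with `D` the hop distance between the ends.

Error: with `n = 4 K` links beyond the first, the minimizer decreases linearly and has the same
residual on every link. A state confined to `K` coordinates misses that residual on `K` far even
links, so its Bregman distance exceeds `ε` once `n` is proportional to `√(L R² / ε)`
(`bregman_hardCost_ge`, `hard_instance_estimates`). The function error of one agent is the Bregman
distance of its state copied to all agents, so the same bound covers both metrics. -/

namespace DecOpt

/-! ### Gossip matrices with a prescribed eigengap. -/

open Matrix Polynomial in
/-- A symmetric matrix over `G` that kills the constants and whose characteristic polynomial has
the simple root `0` and otherwise positive roots is a gossip matrix. -/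
theorem isGossipMatrix_of_charpoly {m : ℕ} {G : SimpleGraph (Fin m)}
    {W : Matrix (Fin m) (Fin m) ℝ} (hW : InducedBy G W) (hone : W *ᵥ (fun _ => 1) = 0)
    {lam : Fin m → ℝ} (hchar : W.charpoly = ∏ i, (X - C (lam i))) (i₀ : Fin m)
    (h₀ : lam i₀ = 0) (hpos : ∀ i, i ≠ i₀ → 0 < lam i) : IsGossipMatrix G W := by
  have hherm : W.IsHermitian := by
    rw [IsHermitian, conjTranspose_eq_transpose_of_trivial]; exact hW.1
  have hroots : W.charpoly.roots = Finset.univ.val.map lam := by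
    rw [hchar, ← roots_multiset_prod_X_sub_C (Finset.univ.val.map lam), Multiset.map_map]
    rfl
  refine ⟨hW, ?_, ?_⟩
  · rw [hherm.posSemidef_iff_eigenvalues_nonneg]
    intro i
    have : hherm.eigenvalues i ∈ W.charpoly.roots := by
      rw [hherm.roots_charpoly_eq_eigenvalues]
      simp
    rw [hroots] at this
    obtain ⟨j, -, hj⟩ := Multiset.mem_map.1 this
    rw [← hj]
    by_cases h : j = i₀
    · rw [h, h₀]; rfl
    · exact (hpos j h).le
  · have hmult : W.charpoly.rootMultiplicity 0 = 1 := by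
      rw [← count_roots, hroots, Multiset.count_map]
      have : (Finset.univ.filter fun a => (0 : ℝ) = lam a) = {i₀} := by
        ext a
        simp only [Finset.mem_filter, Finset.mem_univ, true_and, Finset.mem_singleton]
        constructor
        · intro h
          by_contra hne
          exact (hpos a hne).ne h
        · rintro rfl; exact h₀.symm
      calc _ = (Finset.univ.filter fun a => (0 : ℝ) = lam a).card := rfl
        _ = 1 := by rw [this]; rfl
    -- The geometric multiplicity of the eigenvalue `0` is at most its algebraic multiplicity, which
    -- is `1`.
    have hfin : Module.finrank ℝ (LinearMap.ker W.mulVecLin) ≤ 1 := by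
      have := LinearMap.finrank_eigenspace_le (W.mulVecLin) 0
      rw [Module.End.eigenspace_zero] at this
      have hchar' : W.mulVecLin.charpoly = W.charpoly := by
        rw [← LinearMap.charpoly_toMatrix _ (Pi.basisFun ℝ (Fin m)),
          LinearMap.toMatrix_eq_toMatrix', ← Matrix.toLin'_apply',
            LinearMap.toMatrix'_toLin']
      rwa [hchar', hmult] at this
    symm
    apply Submodule.eq_of_le_of_finrank_le
    · rw [Submodule.span_singleton_le_iff_mem, LinearMap.mem_ker]
      exact hone
    · rw [finrank_span_singleton]
      · exact hfin
      · intro h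
        exact one_ne_zero (congrFun h i₀)

/-- The graph on `Fin m` joining vertices at distance `1` or `2` along the path. -/
def pathSq (m : ℕ) : SimpleGraph (Fin m) where
  Adj i j := i ≠ j ∧ (i : ℕ) ≤ j + 2 ∧ (j : ℕ) ≤ i + 2
  symm := ⟨fun _ _ h => ⟨h.1.symm, h.2.2, h.2.1⟩⟩
  loopless := ⟨fun _ h => h.1 rfl⟩

theorem pathSq_connected {m : ℕ} (hm : 1 ≤ m) : (pathSq m).Connected := by
  obtain ⟨m, rfl⟩ : ∃ k, m = k + 1 := ⟨m - 1, by omega⟩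
  refine (SimpleGraph.pathGraph_connected m).mono ?_
  intro u v h
  rw [SimpleGraph.pathGraph_adj] at h
  exact ⟨fun e => by subst e; omega, by omega, by omega⟩

/-- The Laplacian of the path on `m` vertices whose edge `{i, i + 1}` has weight
`(i + 1) (m - 1 - i)`. Its eigenvectors are the discrete Chebyshev polynomials. -/
def chebLaplacian (m : ℕ) : Matrix (Fin m) (Fin m) ℝ := Matrix.of fun i j =>
  (if (i : ℕ) = j then ((i : ℝ) + 1) * (m - 1 - i) + i * (m - i) else 0) -
    (if (i : ℕ) + 1 = j then ((i : ℝ) + 1) * (m - 1 - i) else 0) -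
    (if (j : ℕ) + 1 = i then (i : ℝ) * (m - i) else 0)

theorem chebLaplacian_isSymm (m : ℕ) : (chebLaplacian m).IsSymm := by
  ext i j
  simp only [chebLaplacian, Matrix.transpose_apply, Matrix.of_apply]
  rcases lt_trichotomy (i : ℕ) j with h | h | h
  · by_cases h' : (i : ℕ) + 1 = j
    · have : (j : ℝ) = i + 1 := by exact_mod_cast h'.symm
      simp [h', h.ne, h.ne', this, show (j : ℕ) + 1 ≠ i by omega]
      left; ring
    · simp [h', h.ne, h.ne', show (j : ℕ) + 1 ≠ i by omega]
  · have : i = j := Fin.ext h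
    subst this
    rfl
  · by_cases h' : (j : ℕ) + 1 = i
    · have : (i : ℝ) = j + 1 := by exact_mod_cast h'.symm
      simp [h', h.ne, h.ne', this, show (i : ℕ) + 1 ≠ j by omega]
      left; ring
    · simp [h', h.ne, h.ne', show (i : ℕ) + 1 ≠ j by omega]

theorem chebLaplacian_eq_zero {m : ℕ} {i j : Fin m} (h : (i : ℕ) + 1 < j ∨ (j : ℕ) + 1 < i) :
    chebLaplacian m i j = 0 := by
  simp [chebLaplacian, show (i : ℕ) ≠ j by omega, show (i : ℕ) + 1 ≠ j by omega,
    show (j : ℕ) + 1 ≠ i by omega]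

/-- At the two endpoints `φ (i - 1)` or `φ (i + 1)` refers to no neighbor (for `i = 0` the truncated
`i - 1` is `0`), but its weight vanishes there, so one formula serves all rows. -/
theorem sum_chebLaplacian_mul {m : ℕ} (φ : ℕ → ℝ) (i : Fin m) :
    ∑ j, chebLaplacian m i j * φ j =
      ((i : ℝ) + 1) * (m - 1 - i) * (φ i - φ (i + 1)) + i * (m - i) * (φ i - φ (i - 1)) := by
  obtain ⟨i, hi⟩ := i
  simp only [chebLaplacian, Matrix.of_apply]
  rw [Fin.sum_univ_eq_sum_range (fun j => ((if i = j then ((i : ℝ) + 1) * (m - 1 - i) + i * (m - i)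
    else 0) - (if i + 1 = j then ((i : ℝ) + 1) * (m - 1 - i) else 0) -
    (if j + 1 = i then (i : ℝ) * (m - i) else 0)) * φ j) m]
  simp only [sub_mul, Finset.sum_sub_distrib, ite_mul, zero_mul]
  rw [Finset.sum_ite_eq, Finset.sum_ite_eq, if_pos (Finset.mem_range.2 hi)]
  have h1 : (if i + 1 ∈ Finset.range m then ((i : ℝ) + 1) * (m - 1 - i) * φ (i + 1) else 0)
      = ((i : ℝ) + 1) * (m - 1 - i) * φ (i + 1) := by
    split_ifs with h
    · rfl
    · have : (m : ℝ) = i + 1 := by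
        have : m = i + 1 := by simp at h; omega
        exact_mod_cast this
      rw [this]; ring
  have h2 : (∑ j ∈ Finset.range m, if j + 1 = i then (i : ℝ) * (m - i) * φ j else 0)
      = (i : ℝ) * (m - i) * φ (i - 1) := by
    rcases i with _ | i
    · simp
    · simp only [Nat.add_right_cancel_iff, Nat.add_sub_cancel]
      rw [Finset.sum_ite_eq', if_pos (by simp; omega)]
  rw [h1, h2]
  ring

/-- The matrix of `chebLaplacian m` in the basis of binomial coefficients. -/
def chebTriangular (m : ℕ) : Matrix (Fin m) (Fin m) ℝ := Matrix.of fun i k =>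
  (if (i : ℕ) = k then (k : ℝ) * (k + 1) else 0) -
    (if (i : ℕ) + 1 = k then (k : ℝ) * (m - k) else 0)

/-- The lower triangular Pascal matrix. -/
def pascal (m : ℕ) : Matrix (Fin m) (Fin m) ℝ := Matrix.of fun i k => ((i : ℕ).choose k : ℝ)

theorem pascal_det (m : ℕ) : (pascal m).det = 1 := by
  rw [Matrix.det_of_isLowerTriangular]
  · simp [pascal]
  · intro i j h
    have : (i : ℕ) < j := by simpa using h
    simp [pascal, Nat.choose_eq_zero_of_lt this]

theorem chebTriangular_isUpperTriangular (m : ℕ) : (chebTriangular m).IsUpperTriangular := by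
  intro i j h
  have : (j : ℕ) < i := by simpa using h
  simp [chebTriangular, show (i : ℕ) ≠ j by omega, show (i : ℕ) + 1 ≠ j by omega]

/-- Pascal's rule turns differences of binomial coefficients into lower ones, and the absorption
identity swallows the weights `i` and `i + 1`. Only the columns `k` and `k - 1` survive. -/
theorem chebLaplacian_mul_pascal (m : ℕ) :
    chebLaplacian m * pascal m = pascal m * chebTriangular m := by
  ext i k
  rw [Matrix.mul_apply, Matrix.mul_apply]
  have hl := sum_chebLaplacian_mul (fun j => (j.choose k : ℝ)) i
  simp only [pascal, Matrix.of_apply]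
  rw [hl]
  obtain ⟨i, hi⟩ := i
  obtain ⟨k, hk⟩ := k
  simp only [chebTriangular, Matrix.of_apply]
  rw [Fin.sum_univ_eq_sum_range (fun j => (i.choose j : ℝ) *
    ((if j = k then (k : ℝ) * (k + 1) else 0) - (if j + 1 = k then (k : ℝ) * (m - k) else 0))) m]
  simp only [mul_sub, Finset.sum_sub_distrib, mul_ite, mul_zero]
  rw [Finset.sum_ite_eq', if_pos (Finset.mem_range.2 hk)]
  rcases k with _ | k
  · simp
  simp only [Nat.add_right_cancel_iff]
  rw [Finset.sum_ite_eq', if_pos (by simp; omega)]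
  have e1 : ((i + 1).choose (k + 1) : ℝ) = i.choose k + i.choose (k + 1) := by
    exact_mod_cast Nat.choose_succ_succ i k
  have e2 : (i : ℝ) * (i.choose (k + 1) - (i - 1).choose (k + 1)) = (k + 1) * i.choose (k + 1) := by
    rcases i with _ | i
    · simp
    · have h1 : ((i + 1).choose (k + 1) : ℝ) = i.choose k + i.choose (k + 1) := by
        exact_mod_cast Nat.choose_succ_succ i k
      have h2 : ((i : ℝ) + 1) * i.choose k = (i + 1).choose (k + 1) * (k + 1) := by
        exact_mod_cast Nat.add_one_mul_choose_eq i k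
      simp only [Nat.add_sub_cancel]
      rw [show ((i + 1 : ℕ) : ℝ) = i + 1 by push_cast; ring]
      linear_combination h2 + ((i : ℝ) + 1) * h1
  have e3 : ((i : ℝ) + 1) * i.choose k = (i + 1).choose (k + 1) * (k + 1) := by
    exact_mod_cast Nat.add_one_mul_choose_eq i k
  rw [e1] at e3 ⊢
  push_cast
  linear_combination ((m : ℝ) - i) * e2 - ((m : ℝ) - 1 - i) * e3 + ((k : ℝ) + 1) * e3

-- Conjugation by the Pascal matrix makes the matrix upper triangular, so its eigenvalues are
-- diagonal entries and no eigenvectors are needed.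
open Matrix Polynomial in
theorem charpoly_quadratic_chebLaplacian (m : ℕ) (a b : ℝ) :
    (a • chebLaplacian m + b • (chebLaplacian m * chebLaplacian m)).charpoly =
      ∏ k : Fin m, (X - C ((k : ℝ) * (k + 1) * (a + b * ((k : ℝ) * (k + 1))))) := by
  have hdet : IsUnit (pascal m).det := by rw [pascal_det]; exact isUnit_one
  obtain ⟨V, hV⟩ := (isUnit_iff_isUnit_det _).2 hdet
  have hmul := chebLaplacian_mul_pascal m
  rw [← hV] at hmul
  have h1 : chebLaplacian m = V.val * chebTriangular m * V⁻¹.val := by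
    rw [← hmul, mul_assoc, Units.mul_inv, mul_one]
  have h2 : a • chebLaplacian m + b • (chebLaplacian m * chebLaplacian m) =
      V.val * (a • chebTriangular m + b • (chebTriangular m * chebTriangular m)) * V⁻¹.val := by
    have : chebLaplacian m * chebLaplacian m =
        V.val * (chebTriangular m * chebTriangular m) * V⁻¹.val := by
      calc _ = V.val * chebTriangular m * (V⁻¹.val * V.val) * chebTriangular m * V⁻¹.val := by
            rw [h1]; simp only [mul_assoc]
        _ = _ := by rw [Units.inv_mul]; simp only [mul_assoc, one_mul]
    rw [this, h1]
    simp only [mul_add, add_mul, mul_smul_comm, smul_mul_assoc]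
  have hT := chebTriangular_isUpperTriangular m
  rw [h2, coe_units_inv, charpoly_units_conj, charpoly_of_isUpperTriangular]
  · refine Finset.prod_congr rfl fun k _ => ?_
    have hdiag : chebTriangular m k k = (k : ℝ) * (k + 1) := by simp [chebTriangular]
    have : (chebTriangular m * chebTriangular m) k k =
        chebTriangular m k k * chebTriangular m k k := by
      rw [mul_apply, Finset.sum_eq_single k]
      · intro j _ hj
        rcases lt_or_gt_of_ne hj with h | h
        · rw [hT h, zero_mul]
        · rw [hT h, mul_zero]
      · simp
    rw [Matrix.add_apply, Matrix.smul_apply, Matrix.smul_apply, this, hdiag]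
    congr 2
    simp only [smul_eq_mul]
    ring
  · intro i j h
    rw [Matrix.add_apply, Matrix.smul_apply, Matrix.smul_apply, hT h, (hT.mul hT) h]
    simp

theorem exists_isGossipMatrix_hasEigengap {η : ℝ} (hη : 0 < η) (hη1 : η ≤ 1) :
    ∃ m : ℕ, 3 ≤ m ∧ 1 ≤ η * (m : ℝ) ^ 2 ∧
      ∃ W, IsGossipMatrix (pathSq m) W ∧ HasEigengap W η := by
  have hex : ∃ m : ℕ, 3 ≤ m ∧ 2 < (m : ℝ) * (m + 1) * η := by
    obtain ⟨N, hN⟩ := exists_nat_gt (2 / η)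
    refine ⟨N + 3, by omega, ?_⟩
    rw [div_lt_iff₀ hη] at hN
    push_cast
    have hN0 : (0 : ℝ) ≤ N := N.cast_nonneg
    nlinarith [mul_nonneg (mul_nonneg hN0 hN0) hη.le, mul_nonneg hN0 hη.le]
  classical
  -- The bound at `m` gives `1 ≤ η m²`; for `m > 3`, its failure at `m - 1` gives `η (m - 1) m ≤ 2`,
  -- that is `0 ≤ b` below.
  obtain ⟨m, ⟨hm3, hm⟩, hmin⟩ : ∃ m : ℕ, (3 ≤ m ∧ 2 < (m : ℝ) * (m + 1) * η) ∧
      ∀ k < m, ¬ (3 ≤ k ∧ 2 < (k : ℝ) * (k + 1) * η) :=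
    ⟨Nat.find hex, Nat.find_spec hex, fun k hk => Nat.find_min hex hk⟩
  have hm3' : (3 : ℝ) ≤ m := by exact_mod_cast hm3
  refine ⟨m, hm3, by nlinarith, ?_⟩
  obtain ⟨M, hM⟩ : ∃ M : ℝ, M = (m - 1) * m := ⟨_, rfl⟩
  have hM6 : 6 ≤ M := by rw [hM]; nlinarith
  -- Solved so that the eigenvalues of indices `1` and `m - 1` are `η` and `1` times `2 M (M - 2)`.
  obtain ⟨a, ha⟩ : ∃ a : ℝ, a = η * M ^ 2 - 4 := ⟨_, rfl⟩
  obtain ⟨b, hb⟩ : ∃ b : ℝ, b = 2 - η * M := ⟨_, rfl⟩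
  -- For `m = 3` the coefficients may be negative, but the only nonzero eigenvalues are the two that
  -- were prescribed.
  have hcase : m = 3 ∨ 0 ≤ a ∧ 0 ≤ b := by
    rcases hm3.eq_or_lt with h | h
    · exact Or.inl h.symm
    · right
      have h1 := hmin (m - 1) (by omega)
      rw [not_and, not_lt, Nat.cast_sub (by omega)] at h1
      have h2 := h1 (by omega)
      push_cast at h2
      have h4 : (4 : ℝ) ≤ m := by exact_mod_cast h
      constructor
      · have h5 : 2 * (m - 1) < (m + 1) * (η * M) := by
          rw [hM]; nlinarith
        have h6 : 1 ≤ η * M := by nlinarith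
        rw [ha]
        nlinarith
      · rw [hb, hM]
        nlinarith
  let lam : Fin m → ℝ := fun k => (k : ℝ) * (k + 1) * (a + b * ((k : ℝ) * (k + 1)))
  have hlam1 : lam ⟨1, by omega⟩ = 2 * η * M * (M - 2) := by
    simp only [lam, ha, hb]
    push_cast
    ring
  have hlamm : lam ⟨m - 1, by omega⟩ = 2 * M * (M - 2) := by
    simp only [lam, ha, hb]
    rw [Nat.cast_sub (by omega)]
    push_cast
    rw [sub_add_cancel, ← hM]
    ring
  have hmono : Monotone lam := by
    rcases hcase with rfl | ⟨ha0, hb0⟩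
    · have h0 : lam 0 = 0 := by simp [lam]
      have h1 : lam 1 = 2 * η * M * (M - 2) := hlam1
      have h2 : lam 2 = 2 * M * (M - 2) := hlamm
      have hMM : 0 ≤ M * (M - 2) := by nlinarith
      have h01 : lam 0 ≤ lam 1 := by rw [h0, h1]; nlinarith
      have h12 : lam 1 ≤ lam 2 := by rw [h1, h2]; nlinarith
      rw [Fin.monotone_iff_le_succ]
      intro i
      fin_cases i
      · exact h01
      · exact h12
    · intro i j hij
      have : (i : ℝ) ≤ j := by exact_mod_cast hij
      simp only [lam]
      gcongr
  have hpos1 : 0 < lam ⟨1, by omega⟩ := by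
    rw [hlam1]
    have : 0 < M - 2 := by linarith
    positivity
  have hchar := charpoly_quadratic_chebLaplacian m a b
  refine ⟨a • chebLaplacian m + b • (chebLaplacian m * chebLaplacian m), ?_, lam, hmono, ?_,
    by omega, ?_⟩
  · have hsym := chebLaplacian_isSymm m
    refine isGossipMatrix_of_charpoly ⟨?_, ?_⟩ ?_ hchar ⟨0, by omega⟩ (by simp) ?_
    · refine (hsym.smul a).add (Matrix.IsSymm.smul ?_ b)
      rw [Matrix.IsSymm, Matrix.transpose_mul, hsym.eq]
    · intro i j hne
      by_contra hcon
      push Not at hcon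
      obtain ⟨hij, hadj⟩ := hcon
      apply hne
      have hfar : (i : ℕ) + 2 < j ∨ (j : ℕ) + 2 < i := by
        by_contra h
        exact hadj ⟨hij, by omega, by omega⟩
      rw [Matrix.add_apply, Matrix.smul_apply, Matrix.smul_apply, Matrix.mul_apply,
        chebLaplacian_eq_zero (by omega), Finset.sum_eq_zero]
      · simp
      · intro k _
        by_cases hk : (i : ℕ) + 1 < k ∨ (k : ℕ) + 1 < i
        · rw [chebLaplacian_eq_zero hk, zero_mul]
        · rw [chebLaplacian_eq_zero (i := k) (j := j) (by omega), mul_zero]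
    · have h1 : (chebLaplacian m).mulVec (fun _ => 1) = 0 := by
        ext i
        have := sum_chebLaplacian_mul (fun _ => 1) i
        simpa [Matrix.mulVec, dotProduct] using this
      rw [Matrix.add_mulVec, Matrix.smul_mulVec, Matrix.smul_mulVec, ← Matrix.mulVec_mulVec, h1]
      simp
    · intro i hi
      refine hpos1.trans_le (hmono ?_)
      rw [Fin.le_def]
      have : (i : ℕ) ≠ 0 := fun h => hi (Fin.ext h)
      show 1 ≤ (i : ℕ)
      omega
  · rw [hchar, ← Polynomial.roots_multiset_prod_X_sub_C (Finset.univ.val.map lam),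
      Multiset.map_map]
    rfl
  · rw [hlam1, hlamm]
    have : M - 2 ≠ 0 := by linarith
    field_simp


/-! ### Least-squares costs with orthogonal rows. -/

/-- The least-squares cost `(L / 4) ∑_{j ∈ S} (⟨w j, x⟩ - b j)²`. -/
noncomputable def quadCost {d : ℕ} (L : ℝ) (S : Finset ℕ) (w : ℕ → EuclideanSpace ℝ (Fin d))
    (b : ℕ → ℝ) (x : EuclideanSpace ℝ (Fin d)) : ℝ :=
  L / 4 * ∑ j ∈ S, (inner ℝ (w j) x - b j) ^ 2

section quadCost

variable {d : ℕ} {L : ℝ} {S : Finset ℕ} {w : ℕ → EuclideanSpace ℝ (Fin d)} {b : ℕ → ℝ}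

theorem hasGradientAt_quadCost (x : EuclideanSpace ℝ (Fin d)) :
    HasGradientAt (quadCost L S w b)
      ((L / 2) • ∑ j ∈ S, (inner ℝ (w j) x - b j) • w j) x := by
  rw [hasGradientAt_iff_hasFDerivAt]
  have h : ∀ j ∈ S, HasFDerivAt (fun x => (inner ℝ (w j) x - b j) ^ 2)
      ((2 * (inner ℝ (w j) x - b j)) • innerSL ℝ (w j)) x := by
    intro j _
    have h1 : HasFDerivAt (fun x => inner ℝ (w j) x - b j) (innerSL ℝ (w j)) x :=
      ((innerSL ℝ (w j)).hasFDerivAt).sub_const _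
    simpa using h1.pow 2
  have h2 := (HasFDerivAt.fun_sum h).const_mul (L / 4)
  refine h2.congr_fderiv ?_
  ext v
  simp only [smul_apply, sum_apply, innerSL_apply_apply,
    InnerProductSpace.toDual_apply_apply, inner_smul_left, sum_inner, smul_eq_mul, Finset.mul_sum]
  refine Finset.sum_congr rfl fun j _ => ?_
  simp
  ring

theorem gradient_quadCost (x : EuclideanSpace ℝ (Fin d)) :
    gradient (quadCost L S w b) x = (L / 2) • ∑ j ∈ S, (inner ℝ (w j) x - b j) • w j :=
  (hasGradientAt_quadCost x).gradient

theorem quadCost_bregman (x y : EuclideanSpace ℝ (Fin d)) :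
    quadCost L S w b y - quadCost L S w b x - inner ℝ (gradient (quadCost L S w b) x) (y - x) =
      L / 4 * ∑ j ∈ S, (inner ℝ (w j) (y - x)) ^ 2 := by
  rw [gradient_quadCost, inner_smul_left, sum_inner]
  simp only [quadCost, inner_smul_left, inner_sub_right]
  rw [Finset.mul_sum, Finset.mul_sum, Finset.mul_sum, Finset.mul_sum, ← Finset.sum_sub_distrib,
    ← Finset.sum_sub_distrib]
  refine Finset.sum_congr rfl fun j _ => ?_
  simp
  ring

/-- For the sum `v`, orthogonality gives `‖v‖² = ∑ ⟨w j, z⟩² ‖w j‖² ≤ 2 ⟨v, z⟩`, and Cauchy–Schwarz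
finishes. This factor `2` is why the prefactor `L / 4` yields `L`-smoothness. -/
theorem norm_sum_inner_smul_le (hw : ∀ j ∈ S, ‖w j‖ ^ 2 ≤ 2)
    (ho : ∀ i ∈ S, ∀ j ∈ S, i ≠ j → inner ℝ (w i) (w j) = 0) (z : EuclideanSpace ℝ (Fin d)) :
    ‖∑ j ∈ S, (inner ℝ (w j) z : ℝ) • w j‖ ≤ 2 * ‖z‖ := by
  set v := ∑ j ∈ S, (inner ℝ (w j) z : ℝ) • w j with hv
  have h1 : inner ℝ v z = ∑ j ∈ S, (inner ℝ (w j) z) ^ 2 := by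
    rw [hv, sum_inner]
    refine Finset.sum_congr rfl fun j _ => ?_
    rw [inner_smul_left]
    simp
    ring
  have h2 : ‖v‖ ^ 2 = ∑ j ∈ S, (inner ℝ (w j) z) ^ 2 * ‖w j‖ ^ 2 := by
    rw [← real_inner_self_eq_norm_sq]
    conv_lhs => rw [hv]
    rw [sum_inner]
    refine Finset.sum_congr rfl fun i hi => ?_
    rw [inner_smul_left, inner_sum, Finset.sum_eq_single i]
    · rw [inner_smul_right, real_inner_self_eq_norm_sq]
      simp
      ring
    · intro j hj hji
      rw [inner_smul_right, ho i hi j hj hji.symm, mul_zero]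
    · exact fun h => absurd hi h
  have h3 : ‖v‖ ^ 2 ≤ 2 * inner ℝ v z := by
    rw [h2, h1, Finset.mul_sum]
    refine Finset.sum_le_sum fun j hj => ?_
    nlinarith [hw j hj, sq_nonneg (inner ℝ (w j) z : ℝ)]
  have h4 := real_inner_le_norm v z
  rcases (norm_nonneg v).eq_or_lt with h | h
  · rw [← h]; positivity
  · nlinarith

theorem isConvexSmooth_quadCost (hL : 0 ≤ L) (hw : ∀ j ∈ S, ‖w j‖ ^ 2 ≤ 2)
    (ho : ∀ i ∈ S, ∀ j ∈ S, i ≠ j → inner ℝ (w i) (w j) = 0) :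
    IsConvexSmooth L (quadCost L S w b) where
  convex := by
    refine ⟨convex_univ, fun x _ y _ s t hs ht hst => ?_⟩
    simp only [quadCost, smul_eq_mul]
    have h : ∀ j ∈ S, (inner ℝ (w j) (s • x + t • y) - b j) ^ 2 ≤
        s * (inner ℝ (w j) x - b j) ^ 2 + t * (inner ℝ (w j) y - b j) ^ 2 := by
      intro j _
      rw [inner_add_right, inner_smul_right, inner_smul_right]
      have ht' : t = 1 - s := by linarith
      subst ht'
      nlinarith [mul_nonneg (mul_nonneg hs ht)
        (sq_nonneg ((inner ℝ (w j) x : ℝ) - inner ℝ (w j) y))]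
    have h' := Finset.sum_le_sum h
    rw [Finset.sum_add_distrib, ← Finset.mul_sum, ← Finset.mul_sum] at h'
    nlinarith [mul_le_mul_of_nonneg_left h' (show 0 ≤ L / 4 by positivity)]
  differentiable x := (hasGradientAt_quadCost x).differentiableAt
  lipschitz x y := by
    rw [gradient_quadCost, gradient_quadCost, ← smul_sub, ← Finset.sum_sub_distrib]
    have : ∑ j ∈ S, ((inner ℝ (w j) x - b j) • w j - (inner ℝ (w j) y - b j) • w j) =
        ∑ j ∈ S, (inner ℝ (w j) (x - y) : ℝ) • w j := by
      refine Finset.sum_congr rfl fun j _ => ?_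
      rw [← sub_smul, inner_sub_right]
      congr 1
      ring
    rw [this, norm_smul, Real.norm_of_nonneg (by positivity)]
    have := mul_le_mul_of_nonneg_left (norm_sum_inner_smul_le hw ho (x - y))
      (show 0 ≤ L / 2 by positivity)
    linarith

end quadCost

/-! ### The chain of differences and its solution. -/

/-- The `j`-th difference vector `e_j - e_{j-1}` of the chain on the first `n` coordinates, where
`e_{-1} = e_n = 0`. -/
noncomputable def chainVec (d n j : ℕ) : EuclideanSpace ℝ (Fin d) :=
  WithLp.toLp 2 fun c => (if (c : ℕ) = j ∧ j < n then 1 else 0) - (if (c : ℕ) + 1 = j then 1 else 0)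

/-- The `c`-th coordinate of `x`, extended by zero. -/
noncomputable def coord {d : ℕ} (x : EuclideanSpace ℝ (Fin d)) (c : ℕ) : ℝ :=
  if h : c < d then x ⟨c, h⟩ else 0

theorem sum_ite_mul_coord {d : ℕ} (x : EuclideanSpace ℝ (Fin d)) (j : ℕ) :
    ∑ c : Fin d, (if (c : ℕ) = j then 1 else 0) * x c = coord x j := by
  unfold coord
  split_ifs with h
  · rw [Finset.sum_eq_single ⟨j, h⟩]
    · simp
    · intro c _ hc
      rw [if_neg (fun e => hc (Fin.ext e)), zero_mul]
    · simp
  · refine Finset.sum_eq_zero fun c _ => ?_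
    rw [if_neg (by have := c.2; omega), zero_mul]

theorem inner_chainVec {d n j : ℕ} (x : EuclideanSpace ℝ (Fin d)) :
    (inner ℝ (chainVec d n j) x : ℝ) =
      (if j < n then coord x j else 0) - (if j = 0 then 0 else coord x (j - 1)) := by
  rw [PiLp.inner_apply]
  have h1 : ∀ c : Fin d, (inner ℝ (chainVec d n j c) (x c) : ℝ) =
      (if j < n then (if (c : ℕ) = j then 1 else 0) * x c else 0) -
        (if j = 0 then 0 else (if (c : ℕ) = j - 1 then 1 else 0) * x c) := by
    intro c
    simp only [chainVec, RCLike.inner_apply, conj_trivial]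
    rw [mul_comm, sub_mul]
    congr 1
    · by_cases h : j < n <;> simp [h]
    · by_cases h : j = 0
      · simp [h]
      · have : (c : ℕ) + 1 = j ↔ (c : ℕ) = j - 1 := by omega
        simp [h, this]
  rw [Finset.sum_congr rfl fun c _ => h1 c, Finset.sum_sub_distrib]
  congr 1
  · split_ifs
    · exact sum_ite_mul_coord x j
    · simp
  · split_ifs
    · simp
    · exact sum_ite_mul_coord x (j - 1)

theorem coord_chainVec {d n j c : ℕ} (hc : c < d) : coord (chainVec d n j) c =
    (if c = j ∧ j < n then 1 else 0) - (if c + 1 = j then 1 else 0) := by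
  simp [coord, hc, chainVec]

theorem coord_chainVec_eq_zero {d n j c : ℕ} (h1 : c ≠ j) (h2 : c + 1 ≠ j) :
    coord (chainVec d n j) c = 0 := by
  unfold coord
  split_ifs
  · simp [chainVec, h1, h2]
  · rfl

theorem norm_sq_chainVec_le (d n j : ℕ) : ‖chainVec d n j‖ ^ 2 ≤ 2 := by
  rw [← real_inner_self_eq_norm_sq, inner_chainVec]
  have h1 : (if j < n then coord (chainVec d n j) j else 0) ≤ 1 := by
    split_ifs with h
    · by_cases hd : j < d
      · rw [coord_chainVec hd]; simp [h]
      · simp [coord, hd]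
    · norm_num
  have h2 : -1 ≤ (if j = 0 then 0 else coord (chainVec d n j) (j - 1)) := by
    split_ifs with h
    · norm_num
    · by_cases hd : j - 1 < d
      · rw [coord_chainVec hd, if_neg (by omega), if_pos (by omega)]; norm_num
      · simp [coord, hd]
  linarith

theorem inner_chainVec_chainVec {d n i j : ℕ} (hij : i ≠ j) (h1 : i + 1 ≠ j) (h2 : j + 1 ≠ i) :
    (inner ℝ (chainVec d n i) (chainVec d n j) : ℝ) = 0 := by
  rw [inner_chainVec, coord_chainVec_eq_zero hij h1]
  rcases i with _ | i
  · simp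
  · rw [Nat.add_sub_cancel, coord_chainVec_eq_zero (by omega) hij]
    simp

/-- The vectors supported on the first `K` coordinates. -/
def coordsBelow (d K : ℕ) : Submodule ℝ (EuclideanSpace ℝ (Fin d)) where
  carrier := {x | ∀ c : Fin d, K ≤ c → x c = 0}
  add_mem' hx hy c hc := by simp [hx c hc, hy c hc]
  zero_mem' c _ := rfl
  smul_mem' a x hx c hc := by simp [hx c hc]

theorem coordsBelow_mono (d : ℕ) : Monotone (coordsBelow d) :=
  fun _ _ h _ hx c hc => hx c (h.trans hc)

theorem coord_eq_zero {d K : ℕ} {x : EuclideanSpace ℝ (Fin d)} (hx : x ∈ coordsBelow d K) {c : ℕ}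
    (hc : K ≤ c) : coord x c = 0 := by
  unfold coord
  split_ifs with h
  · exact hx ⟨c, h⟩ hc
  · rfl

theorem inner_chainVec_eq_zero {d n K j : ℕ} {x : EuclideanSpace ℝ (Fin d)}
    (hx : x ∈ coordsBelow d K) (hj : K < j) : (inner ℝ (chainVec d n j) x : ℝ) = 0 := by
  rw [inner_chainVec, coord_eq_zero hx hj.le, coord_eq_zero hx (by omega)]
  simp

/-- The local costs: the part of the chain of differences, anchored at the value `a`, whose links
belong to `S`. -/
noncomputable def chainCost (d n : ℕ) (L a : ℝ) (S : Finset ℕ) : EuclideanSpace ℝ (Fin d) → ℝ :=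
  quadCost L S (chainVec d n) fun j => if j = 0 then a else 0

/-- A link `j < K` touches only coordinates below `K`. A link `j > K` has zero residual on `x`,
because only link `0` is anchored. Thus link `K` alone can open a new coordinate. -/
theorem gradient_chainCost_mem {d n K : ℕ} {L a : ℝ} {S : Finset ℕ} (hK : K ∉ S)
    {x : EuclideanSpace ℝ (Fin d)} (hx : x ∈ coordsBelow d K) :
    gradient (chainCost d n L a S) x ∈ coordsBelow d K := by
  rw [chainCost, gradient_quadCost]
  refine Submodule.smul_mem _ _ (Submodule.sum_mem _ fun j hj => ?_)
  rcases lt_trichotomy j K with h | rfl | h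
  · refine Submodule.smul_mem _ _ fun c hc => ?_
    simp [chainVec, show (c : ℕ) ≠ j by omega, show (c : ℕ) + 1 ≠ j by omega]
  · exact absurd hj hK
  · rw [inner_chainVec_eq_zero hx h, if_neg (by omega), sub_zero, zero_smul]
    exact zero_mem _

/-- The links of the chain of parity `r`. -/
def parityLinks (n r : ℕ) : Finset ℕ := (Finset.range (n + 1)).filter (· % 2 = r)

theorem mem_parityLinks {n r j : ℕ} : j ∈ parityLinks n r ↔ j < n + 1 ∧ j % 2 = r := by
  simp [parityLinks]

/-- Distinct links of equal parity share no coordinate, hence are orthogonal. -/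
theorem isConvexSmooth_chainCost {d n : ℕ} {L a : ℝ} (hL : 0 ≤ L) {S : Finset ℕ} {r : ℕ}
    (hS : S ⊆ parityLinks n r) : IsConvexSmooth L (chainCost d n L a S) := by
  refine isConvexSmooth_quadCost hL (fun j _ => norm_sq_chainVec_le d n j) fun i hi j hj hij => ?_
  have h1 := (mem_parityLinks.1 (hS hi)).2
  have h2 := (mem_parityLinks.1 (hS hj)).2
  exact inner_chainVec_chainVec hij (by omega) (by omega)

/-- The solution of the chain problem: it decreases linearly, by `δ` at each step. -/
noncomputable def chainSol (d n : ℕ) (δ : ℝ) : EuclideanSpace ℝ (Fin d) :=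
  WithLp.toLp 2 fun c => if (c : ℕ) < n then δ * (n - c) else 0

theorem inner_chainVec_chainSol {d n j : ℕ} (δ : ℝ) (hn : n ≤ d) (hj : j ≤ n) :
    (inner ℝ (chainVec d n j) (chainSol d n δ) : ℝ) - (if j = 0 then (n + 1) * δ else 0) = -δ := by
  have h : ∀ c, c < n → coord (chainSol d n δ) c = δ * (n - c) := by
    intro c hc
    simp [coord, chainSol, hc, hc.trans_le hn]
  have h1 : (if j < n then coord (chainSol d n δ) j else 0) = δ * (n - j) := by
    split_ifs with hlt
    · exact h j hlt
    · have : j = n := by omega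
      simp [this]
  rw [inner_chainVec, h1]
  rcases j with _ | j
  · simp; ring
  · rw [if_neg (by omega), if_neg (by omega), Nat.add_sub_cancel, h j (by omega)]
    push_cast
    ring

theorem sum_fin_ite_lt {d n : ℕ} (hn : n ≤ d) (g : ℕ → ℝ) :
    ∑ c : Fin d, (if (c : ℕ) < n then g c else 0) = ∑ c ∈ Finset.range n, g c := by
  rw [Fin.sum_univ_eq_sum_range (fun c => if c < n then g c else 0) d, ← Finset.sum_filter]
  congr 1
  ext c
  simp only [Finset.mem_filter, Finset.mem_range]
  omega

theorem norm_sq_chainSol {d n : ℕ} (δ : ℝ) (hn : n ≤ d) :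
    ‖chainSol d n δ‖ ^ 2 = δ ^ 2 * (n * (n + 1) * (2 * n + 1) / 6) := by
  rw [EuclideanSpace.norm_sq_eq]
  have h : ∀ c : Fin d, ‖chainSol d n δ c‖ ^ 2 =
      if (c : ℕ) < n then δ ^ 2 * ((n : ℝ) - (c : ℕ)) ^ 2 else 0 := by
    intro c
    simp only [chainSol]
    split_ifs
    · rw [Real.norm_eq_abs, sq_abs, mul_pow]
    · simp
  rw [Finset.sum_congr rfl fun c _ => h c,
    sum_fin_ite_lt hn fun c => δ ^ 2 * ((n : ℝ) - c) ^ 2, ← Finset.mul_sum]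
  congr 1
  clear hn h
  induction n with
  | zero => simp
  | succ n ih =>
    rw [Finset.sum_range_succ']
    simp only [Nat.cast_add, Nat.cast_one, add_sub_add_right_eq_sub]
    rw [ih]
    push_cast
    ring

theorem sum_parityLinks_chainVec_apply {d n : ℕ} (r : ℕ) (c : Fin d) :
    (∑ j ∈ parityLinks n r, chainVec d n j) c =
      if (c : ℕ) < n then
        (if (c : ℕ) % 2 = r then 1 else 0) - (if ((c : ℕ) + 1) % 2 = r then 1 else 0)
      else 0 := by
  rw [WithLp.ofLp_sum, Finset.sum_apply]
  simp only [chainVec, Finset.sum_sub_distrib]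
  have h1 : ∑ j ∈ parityLinks n r, (if (c : ℕ) = j ∧ j < n then (1 : ℝ) else 0) =
      if (c : ℕ) < n ∧ (c : ℕ) % 2 = r then 1 else 0 := by
    have : ∀ j ∈ parityLinks n r, (if (c : ℕ) = j ∧ j < n then (1 : ℝ) else 0) =
        if (c : ℕ) = j then (if (c : ℕ) < n then 1 else 0) else 0 := by
      intro j _
      by_cases h : (c : ℕ) = j
      · subst h; simp
      · simp [h]
    rw [Finset.sum_congr rfl this, Finset.sum_ite_eq]
    simp only [mem_parityLinks]
    split_ifs <;> first | rfl | omega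
  have h2 : ∑ j ∈ parityLinks n r, (if (c : ℕ) + 1 = j then (1 : ℝ) else 0) =
      if (c : ℕ) < n ∧ ((c : ℕ) + 1) % 2 = r then 1 else 0 := by
    rw [Finset.sum_ite_eq]
    simp only [mem_parityLinks]
    split_ifs <;> first | rfl | omega
  rw [h1, h2]
  by_cases h : (c : ℕ) < n <;> simp [h]

/-- Links of one parity have disjoint supports that tile the first `n` coordinates with entries
`±1`. -/
theorem norm_sq_sum_parityLinks_chainVec {d n r : ℕ} (hn : n ≤ d) (hr : r < 2) :
    ‖∑ j ∈ parityLinks n r, chainVec d n j‖ ^ 2 = n := by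
  rw [EuclideanSpace.norm_sq_eq]
  have h : ∀ c : Fin d, ‖(∑ j ∈ parityLinks n r, chainVec d n j) c‖ ^ 2 =
      if (c : ℕ) < n then (1 : ℝ) else 0 := by
    intro c
    rw [sum_parityLinks_chainVec_apply]
    split_ifs with h h1 h2 h2 <;> first | omega | norm_num
  rw [Finset.sum_congr rfl fun c _ => h c, sum_fin_ite_lt hn fun _ => 1]
  simp

theorem sum_parityLinks_chainVec_add (d n : ℕ) :
    ∑ j ∈ parityLinks n 0, chainVec d n j + ∑ j ∈ parityLinks n 1, chainVec d n j = 0 := by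
  ext c
  rw [PiLp.add_apply, sum_parityLinks_chainVec_apply, sum_parityLinks_chainVec_apply,
    PiLp.zero_apply]
  split_ifs <;> first | omega | norm_num

theorem gradient_chainCost_chainSol {d n : ℕ} {L δ : ℝ} (hn : n ≤ d) {S : Finset ℕ}
    (hS : ∀ j ∈ S, j ≤ n) :
    gradient (chainCost d n L ((n + 1) * δ) S) (chainSol d n δ) =
      (-(L / 2 * δ)) • ∑ j ∈ S, chainVec d n j := by
  rw [chainCost, gradient_quadCost, Finset.smul_sum, Finset.smul_sum]
  refine Finset.sum_congr rfl fun j hj => ?_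
  rw [inner_chainVec_chainSol δ hn (hS j hj), smul_smul]
  congr 1
  ring

/-- A vector supported on the first `K` of `4 K` coordinates is far from the solution in the
Bregman distance of the even links. -/
theorem chainCost_bregman_ge {d K : ℕ} {L δ : ℝ} (hL : 0 ≤ L) (hn : 4 * K ≤ d)
    {y : EuclideanSpace ℝ (Fin d)} (hy : y ∈ coordsBelow d K) :
    L / 4 * (K * δ ^ 2) ≤ L / 4 * ∑ j ∈ parityLinks (4 * K) 0,
      (inner ℝ (chainVec d (4 * K) j) (y - chainSol d (4 * K) δ)) ^ 2 := by
  refine mul_le_mul_of_nonneg_left ?_ (by positivity)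
  -- These are the `K` even links in `(2 K, 4 K]`. There `y` contributes nothing, so each link
  -- retains the full residual `δ`.
  have hinj : Function.Injective fun l : ℕ => 2 * K + 2 * l + 2 := fun a b h => by
    simp at h; omega
  have hsub : (Finset.range K).image (fun l => 2 * K + 2 * l + 2) ⊆ parityLinks (4 * K) 0 := by
    intro j hj
    obtain ⟨l, hl, rfl⟩ := Finset.mem_image.1 hj
    rw [Finset.mem_range] at hl
    rw [mem_parityLinks]
    omega
  refine le_trans ?_ (Finset.sum_le_sum_of_subset_of_nonneg hsub fun _ _ _ => sq_nonneg _)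
  rw [Finset.sum_image fun a _ b _ h => hinj h]
  have : ∀ l ∈ Finset.range K, (inner ℝ (chainVec d (4 * K) (2 * K + 2 * l + 2))
      (y - chainSol d (4 * K) δ)) ^ 2 = δ ^ 2 := by
    intro l hl
    rw [Finset.mem_range] at hl
    have h := inner_chainVec_chainSol (j := 2 * K + 2 * l + 2) δ hn (by omega)
    rw [if_neg (by omega), sub_zero] at h
    rw [inner_sub_right, inner_chainVec_eq_zero hy (by omega), h]
    ring
  rw [Finset.sum_congr rfl this]
  simp


/-! ### Speed of propagation through the network. -/

/-- Propagation of the support: if at level `K` the gradient of an agent can enlarge `V K` only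
where the potential `π K` vanishes, and consecutive levels are `D` hops apart, then each level
takes time `1 + τ D`. -/
theorem IsFirstOrderTrajectory.mem_of_le {m d : ℕ} {G : SimpleGraph (Fin m)} {τ D : ℝ}
    {f : Fin m → EuclideanSpace ℝ (Fin d) → ℝ} {x : ℝ → Fin m → EuclideanSpace ℝ (Fin d)}
    (hx : IsFirstOrderTrajectory G τ f x) (hτ : 0 < τ) (hD : 0 < D)
    {V : ℕ → Submodule ℝ (EuclideanSpace ℝ (Fin d))} (hV : Monotone V) {π : ℕ → Fin m → ℝ}
    (hadj : ∀ K i j, G.Adj i j → π K j ≤ π K i + 1)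
    (hsucc : ∀ K i, π (K + 1) i = 0 → π K i = D)
    (hgrad : ∀ K i, π K i ≠ 0 → ∀ y ∈ V K, gradient (f i) y ∈ V K) {t : ℝ} (ht : 0 ≤ t) {K : ℕ}
    {i : Fin m} (hle : t ≤ K * (1 + τ * D) + τ * π K i) : x t i ∈ V K := by
  have hμ : 0 < min τ 1 := lt_min hτ one_pos
  -- Time is continuous, so the induction counts intervals of length `min τ 1`: every state depends
  -- only on states older than that.
  have key : ∀ N : ℕ, ∀ t, 0 ≤ t → t < N * min τ 1 → ∀ K i,
      t ≤ K * (1 + τ * D) + τ * π K i → x t i ∈ V K := by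
    intro N
    induction N with
    | zero =>
      intro t ht htN
      simp only [Nat.cast_zero, zero_mul] at htN
      exact absurd htN (not_lt.2 ht)
    | succ N ih =>
      intro t ht htN K i hle
      have h1 : (N + 1 : ℕ) * min τ 1 = N * min τ 1 + min τ 1 := by push_cast; ring
      rw [h1] at htN
      have hμτ := min_le_left τ 1
      have hμ1 := min_le_right τ 1
      refine (sup_le ?_ ?_ : _ ≤ V K) (hx.step t ht i)
      · rw [Submodule.span_le]
        rintro v ⟨j, s, hij, hs, hst, rfl⟩
        refine ih s hs (by linarith) K j ?_
        have := mul_le_mul_of_nonneg_left (hadj K j i hij.symm) hτ.le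
        linarith
      · rw [Submodule.span_le]
        rintro v ⟨s, hs, hst, rfl | rfl⟩
        · exact ih s hs (by linarith) K i (by linarith)
        · by_cases h0 : π K i = 0
          · rw [h0] at hle
            rcases K with _ | K
            · simp only [Nat.cast_zero, zero_mul, mul_zero, add_zero] at hle
              linarith
            · have hπ := hsucc K i h0
              refine hV K.le_succ (hgrad K i (by rw [hπ]; exact hD.ne') _ ?_)
              refine ih s hs (by linarith) K i ?_
              rw [hπ]
              push_cast at hle
              linarith
          · exact hgrad K i h0 _ (ih s hs (by linarith) K i (by linarith))
  obtain ⟨N, hN⟩ := exists_nat_gt (t / min τ 1)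
  exact key N t ht ((div_lt_iff₀ hμ).1 hN) K i hle

/-! ### The hard instance: its minimizer, error metrics and support growth. -/

/-- The links held by agent `i`: the first `k` agents hold the even links, the last `k` agents the
odd ones. -/
def agentLinks (m k n : ℕ) (i : Fin m) : Finset ℕ :=
  if (i : ℕ) < k then parityLinks n 0 else if m - k ≤ (i : ℕ) then parityLinks n 1 else ∅

theorem sum_agentLinks {M : Type*} [AddCommGroup M] {m k n : ℕ} (hk : 2 * k ≤ m)
    (φ : Finset ℕ → M) (hφ : φ ∅ = 0) :
    ∑ i : Fin m, φ (agentLinks m k n i) = k • φ (parityLinks n 0) + k • φ (parityLinks n 1) := by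
  have h : ∀ i : Fin m, φ (agentLinks m k n i) =
      (if (i : ℕ) < k then φ (parityLinks n 0) else 0) +
        (if m - k ≤ (i : ℕ) then φ (parityLinks n 1) else 0) := by
    intro i
    unfold agentLinks
    by_cases h1 : (i : ℕ) < k
    · simp [h1, show ¬ m - k ≤ (i : ℕ) by omega]
    · by_cases h2 : m - k ≤ (i : ℕ) <;> simp only [h1, h2, if_true, if_false] <;> simp [hφ]
  rw [Finset.sum_congr rfl fun i _ => h i, Fin.sum_univ_eq_sum_range (fun i =>
    (if i < k then φ (parityLinks n 0) else 0) + (if m - k ≤ i then φ (parityLinks n 1) else 0)) m,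
    Finset.sum_add_distrib, ← Finset.sum_filter, ← Finset.sum_filter, Finset.sum_const,
    Finset.sum_const]
  congr 2
  · rw [show (Finset.range m).filter (· < k) = Finset.range k by
      ext; simp only [Finset.mem_filter, Finset.mem_range]; omega, Finset.card_range]
  · rw [show (Finset.range m).filter (m - k ≤ ·) = Finset.Ico (m - k) m by
      ext; simp only [Finset.mem_filter, Finset.mem_range, Finset.mem_Ico]; omega, Nat.card_Ico]
    omega

theorem agentLinks_subset (m k n : ℕ) (i : Fin m) :
    ∃ r, agentLinks m k n i ⊆ parityLinks n r := by
  unfold agentLinks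
  split_ifs
  · exact ⟨0, subset_rfl⟩
  · exact ⟨1, subset_rfl⟩
  · exact ⟨0, Finset.empty_subset _⟩

theorem le_of_mem_agentLinks {m k n j : ℕ} {i : Fin m} (h : j ∈ agentLinks m k n i) : j ≤ n := by
  obtain ⟨r, hr⟩ := agentLinks_subset m k n i
  have := (mem_parityLinks.1 (hr h)).1
  omega

/-- The local costs of the hard instance on the chain of length `n`. -/
noncomputable def hardCost (m d k n : ℕ) (L δ : ℝ) (i : Fin m) : EuclideanSpace ℝ (Fin d) → ℝ :=
  chainCost d n L ((n + 1) * δ) (agentLinks m k n i)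

section hardCost

variable {m d k n : ℕ} {L δ : ℝ}

theorem sum_gradient_hardCost_chainSol (hk : 2 * k ≤ m) (hn : n ≤ d) :
    ∑ i : Fin m, gradient (hardCost m d k n L δ i) (chainSol d n δ) = 0 := by
  have h : ∀ i : Fin m, gradient (hardCost m d k n L δ i) (chainSol d n δ) =
      (-(L / 2 * δ)) • ∑ j ∈ agentLinks m k n i, chainVec d n j := fun i =>
    gradient_chainCost_chainSol hn fun j hj => le_of_mem_agentLinks hj
  rw [Finset.sum_congr rfl fun i _ => h i, ← Finset.smul_sum,
    sum_agentLinks hk (fun S => ∑ j ∈ S, chainVec d n j) Finset.sum_empty, ← smul_add,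
    sum_parityLinks_chainVec_add, smul_zero, smul_zero]

theorem frobNorm_gradient_hardCost (hk : 2 * k ≤ m) (hn : n ≤ d) :
    frobNorm (fun i : Fin m => gradient (hardCost m d k n L δ i) (chainSol d n δ)) ^ 2 =
      L ^ 2 * δ ^ 2 * (k * n) / 2 := by
  have h : ∀ i : Fin m, ‖gradient (hardCost m d k n L δ i) (chainSol d n δ)‖ ^ 2 =
      (L / 2 * δ) ^ 2 * ‖∑ j ∈ agentLinks m k n i, chainVec d n j‖ ^ 2 := by
    intro i
    rw [hardCost, gradient_chainCost_chainSol hn fun j hj => le_of_mem_agentLinks hj, norm_smul,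
      mul_pow, Real.norm_eq_abs, sq_abs, neg_sq]
  rw [frobNorm, Real.sq_sqrt (Finset.sum_nonneg fun _ _ => sq_nonneg _),
    Finset.sum_congr rfl fun i _ => h i, ← Finset.mul_sum,
    sum_agentLinks hk (fun S => ‖∑ j ∈ S, chainVec d n j‖ ^ 2) (by simp),
    norm_sq_sum_parityLinks_chainVec hn (by norm_num),
    norm_sq_sum_parityLinks_chainVec hn (by norm_num)]
  simp only [nsmul_eq_mul]
  ring

theorem bregman_hardCost (x : EuclideanSpace ℝ (Fin d)) (y : Fin m → EuclideanSpace ℝ (Fin d)) :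
    bregman (hardCost m d k n L δ) x y =
      ∑ i, L / 4 * ∑ j ∈ agentLinks m k n i, (inner ℝ (chainVec d n j) (y i - x)) ^ 2 :=
  Finset.sum_congr rfl fun _ _ => quadCost_bregman _ _

/-- At consensus the linear terms of the Bregman distance cancel, since the local gradients sum to
zero at the solution. -/
theorem objective_hardCost (hk : 2 * k ≤ m) (hn : n ≤ d) (y : EuclideanSpace ℝ (Fin d)) :
    objective (hardCost m d k n L δ) y - objective (hardCost m d k n L δ) (chainSol d n δ) =
      bregman (hardCost m d k n L δ) (chainSol d n δ) fun _ => y := by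
  rw [bregman, Finset.sum_sub_distrib, ← sum_inner, sum_gradient_hardCost_chainSol hk hn,
    inner_zero_left, sub_zero, Finset.sum_sub_distrib]
  rfl

theorem isMinOn_objective_hardCost (hL : 0 ≤ L) (hk : 2 * k ≤ m) (hn : n ≤ d) :
    IsMinOn (objective (hardCost m d k n L δ)) Set.univ (chainSol d n δ) := by
  intro y _
  have h := objective_hardCost (L := L) (δ := δ) hk hn y
  rw [bregman_hardCost] at h
  have : 0 ≤ ∑ i : Fin m, L / 4 * ∑ j ∈ agentLinks m k n i,
      (inner ℝ (chainVec d n j) (y - chainSol d n δ)) ^ 2 :=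
    Finset.sum_nonneg fun i _ =>
      mul_nonneg (by positivity) (Finset.sum_nonneg fun _ _ => sq_nonneg _)
  rw [← h] at this
  exact sub_nonneg.1 this

theorem bregman_hardCost_ge {K : ℕ} (hL : 0 ≤ L) (hk : k ≤ m) (hn : 4 * K ≤ d)
    {y : Fin m → EuclideanSpace ℝ (Fin d)} (hy : ∀ i, y i ∈ coordsBelow d K) :
    k * (L / 4 * (K * δ ^ 2)) ≤
      bregman (hardCost m d k (4 * K) L δ) (chainSol d (4 * K) δ) y := by
  rw [bregman_hardCost]
  calc (k : ℝ) * (L / 4 * (K * δ ^ 2))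
      = ∑ i : Fin m, if (i : ℕ) < k then L / 4 * (K * δ ^ 2) else 0 := by
        rw [sum_fin_ite_lt hk fun _ => L / 4 * (K * δ ^ 2)]
        simp
    _ ≤ _ := by
        refine Finset.sum_le_sum fun i _ => ?_
        split_ifs with h
        · rw [agentLinks, if_pos h]
          exact chainCost_bregman_ge hL hn (hy i)
        · exact mul_nonneg (by positivity) (Finset.sum_nonneg fun _ _ => sq_nonneg _)

theorem bregman_le_fem_hardCost (hL : 0 ≤ L) (hk : 2 * k ≤ m) (hn : n ≤ d)
    (y : Fin m → EuclideanSpace ℝ (Fin d)) (i : Fin m) :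
    bregman (hardCost m d k n L δ) (chainSol d n δ) (fun _ => y i) ≤
      fem (hardCost m d k n L δ) y := by
  rw [← objective_hardCost hk hn]
  have hmin := isMinOn_objective_hardCost (δ := δ) hL hk hn
  have hinf : ⨅ z, objective (hardCost m d k n L δ) z =
      objective (hardCost m d k n L δ) (chainSol d n δ) :=
    le_antisymm (ciInf_le ⟨_, by rintro _ ⟨z, rfl⟩; exact hmin (Set.mem_univ z)⟩ _)
      (le_ciInf fun z => hmin (Set.mem_univ z))
  rw [fem, hinf]
  exact le_ciSup (f := fun i => objective (hardCost m d k n L δ) (y i) -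
    objective (hardCost m d k n L δ) (chainSol d n δ)) (Set.finite_range _).bddAbove i

/-- On the hard instance over `pathSq m`, at time `t ≤ K (1 + τ (m + 1 - 2 k) / 2)` the states of
all agents are supported on the first `K` coordinates. -/
theorem mem_coordsBelow_of_le {τ t : ℝ} {K : ℕ} {x : ℝ → Fin m → EuclideanSpace ℝ (Fin d)}
    (hk : 2 * k ≤ m) (hτ : 0 < τ)
    (hx : IsFirstOrderTrajectory (pathSq m) τ (hardCost m d k n L δ) x) (ht : 0 ≤ t)
    (hle : t ≤ K * (1 + τ * (((m : ℝ) + 1 - 2 * k) / 2))) (i : Fin m) :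
    x t i ∈ coordsBelow d K := by
  have hk' : 2 * (k : ℝ) ≤ m := by exact_mod_cast hk
  obtain ⟨D, hD⟩ : ∃ D : ℝ, D = ((m : ℝ) + 1 - 2 * k) / 2 := ⟨_, rfl⟩
  have hD0 : 0 < D := by rw [hD]; linarith
  rw [← hD] at hle
  -- A hop count from the even end, clipped to `0` on the first `k` agents and to `D` on the last
  -- `k`. The halving reflects that an edge spans at most two path steps.
  let p : Fin m → ℝ := fun i => min D (max 0 (((i : ℝ) + 1 - k) / 2))
  have hp0 : ∀ i, 0 ≤ p i := fun i => le_min hD0.le (le_max_left _ _)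
  have hpD : ∀ i, p i ≤ D := fun i => min_le_left _ _
  have hpadj : ∀ i j, (pathSq m).Adj i j → p j ≤ p i + 1 := by
    intro i j h
    have h1 : (j : ℝ) ≤ i + 2 := by exact_mod_cast h.2.2
    simp only [p]
    rw [← min_add_add_right, ← max_add_add_right]
    refine min_le_min (by linarith) (max_le_max (by linarith) (by linarith))
  -- The holders of link `K` alternate between the two ends with the parity of `K`, so the potential
  -- is reflected at each level.
  let π : ℕ → Fin m → ℝ := fun K i => if K % 2 = 0 then p i else D - p i
  have hπ0 : ∀ K i, 0 ≤ π K i := by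
    intro K i
    simp only [π]
    split_ifs
    · exact hp0 i
    · linarith [hpD i]
  refine hx.mem_of_le (π := π) hτ hD0 (coordsBelow_mono d) ?_ ?_ ?_ ht ?_
  · intro K i j h
    simp only [π]
    split_ifs
    · exact hpadj i j h
    · linarith [hpadj j i h.symm]
  · intro K i h
    simp only [π] at h ⊢
    rcases Nat.mod_two_eq_zero_or_one K with h2 | h2
    · rw [if_neg (by omega)] at h
      rw [if_pos h2]
      linarith
    · rw [if_pos (by omega)] at h
      rw [if_neg (by omega)]
      linarith
  · intro K i h y hy
    refine gradient_chainCost_mem (fun hmem => h ?_) hy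
    unfold agentLinks at hmem
    simp only [π]
    split_ifs at hmem with h1 h2
    · rw [if_pos (mem_parityLinks.1 hmem).2]
      have : (i : ℝ) + 1 ≤ k := by exact_mod_cast h1
      simp only [p]
      rw [max_eq_left (by linarith), min_eq_right hD0.le]
    · rw [if_neg (by rw [(mem_parityLinks.1 hmem).2]; norm_num)]
      have : (m : ℝ) ≤ i + k := by exact_mod_cast (by omega : m ≤ i + k)
      simp only [p]
      rw [min_eq_left, sub_self]
      refine le_trans ?_ (le_max_right _ _)
      rw [hD]
      linarith
    · simp at hmem
  · have := mul_nonneg hτ.le (hπ0 K i)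
    linarith

end hardCost


/-! ### Choice of scales and conclusion. -/

/-- The estimates that fix the scale `n ≈ T = √(L R² / ε)` and the step `δ` of the hard instance. -/
theorem hard_instance_estimates {m k n s T L R ε δ g : ℝ} (hk0 : 0 < k) (hk2 : 2 * k ≤ m)
    (hk4 : m ≤ 4 * k) (hn4 : 4 ≤ n) (hs : s = n * (n + 1) * (2 * n + 1) / 6) (hT : 0 ≤ T)
    (hTn : 256 * n ^ 2 ≤ T ^ 2) (hnT : T ^ 2 ≤ 1024 * n ^ 2) (hε : 0 < ε) (hR : 0 < R)
    (hT2 : T ^ 2 * ε = L * R ^ 2) (hδ2 : δ ^ 2 * (m * s) = R ^ 2) (hg0 : 0 ≤ g)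
    (hg2 : g ^ 2 = L ^ 2 * δ ^ 2 * (k * n) / 2) :
    T ≤ R * g / ε ∧ R * g / ε ≤ 32 * T ∧ ε < k * (L / 4 * (n / 4 * δ ^ 2)) := by
  have hs0 : 0 < s := by rw [hs]; positivity
  have hm0 : 0 < m := by linarith
  have hms : 0 < m * s := by positivity
  have hsle : s ≤ n ^ 3 := by
    rw [hs]
    nlinarith [mul_nonneg (by linarith : 0 ≤ n - 4) (by positivity : 0 ≤ n ^ 2)]
  have hsge : n ^ 3 ≤ 3 * s := by rw [hs]; nlinarith
  have hms_le : m * s ≤ 4 * (k * n ^ 3) := by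
    calc m * s ≤ (4 * k) * n ^ 3 := mul_le_mul hk4 hsle hs0.le (by positivity)
      _ = _ := by ring
  have hms_ge : k * n ^ 3 ≤ 3 / 2 * (m * s) := by
    calc k * n ^ 3 ≤ m / 2 * (3 * s) :=
          mul_le_mul (by linarith) hsge (by positivity) (by positivity)
      _ = _ := by ring
  have hkn : 0 < k * n := by positivity
  have hkn3 : 0 < k * n ^ 3 := by positivity
  have hlow : 256 * (k * n ^ 3) ≤ T ^ 2 * (k * n) := by
    calc 256 * (k * n ^ 3) = 256 * n ^ 2 * (k * n) := by ring
      _ ≤ _ := mul_le_mul_of_nonneg_right hTn hkn.le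
  have hupp : T ^ 2 * (k * n) ≤ 1024 * (k * n ^ 3) := by
    calc T ^ 2 * (k * n) ≤ 1024 * n ^ 2 * (k * n) := mul_le_mul_of_nonneg_right hnT hkn.le
      _ = _ := by ring
  have hh0 : 0 ≤ R * g / ε := by positivity
  -- This identity removes `g`, `δ`, `L`, `R` and `ε`. The claims then reduce to the comparability
  -- of `m s`, `k n³` and `T² k n`.
  have hh2 : (R * g / ε) ^ 2 * (2 * (m * s)) = T ^ 2 * (T ^ 2 * (k * n)) := by
    have h1 : (R * g / ε) ^ 2 * ε ^ 2 = R ^ 2 * g ^ 2 := by field_simp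
    have h2 : ((R * g / ε) ^ 2 * (2 * (m * s))) * ε ^ 2 = T ^ 2 * (T ^ 2 * (k * n)) * ε ^ 2 := by
      calc _ = ((R * g / ε) ^ 2 * ε ^ 2) * (2 * (m * s)) := by ring
        _ = R ^ 2 * L ^ 2 * (k * n) * (δ ^ 2 * (m * s)) := by rw [h1, hg2]; ring
        _ = (L * R ^ 2) ^ 2 * (k * n) := by rw [hδ2]; ring
        _ = _ := by rw [← hT2]; ring
    exact mul_right_cancel₀ (by positivity) h2
  refine ⟨?_, ?_, ?_⟩
  · refine (sq_le_sq₀ hT hh0).1 ?_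
    refine le_of_mul_le_mul_right ?_ (show 0 < 2 * (m * s) by positivity)
    rw [hh2]
    exact mul_le_mul_of_nonneg_left (by linarith) (sq_nonneg T)
  · refine (sq_le_sq₀ hh0 (by linarith)).1 ?_
    refine le_of_mul_le_mul_right ?_ (show 0 < 2 * (m * s) by positivity)
    rw [hh2, mul_pow, mul_comm ((32 : ℝ) ^ 2), mul_assoc]
    exact mul_le_mul_of_nonneg_left (by linarith) (sq_nonneg T)
  · refine lt_of_mul_lt_mul_right ?_ hms.le
    have h1 : k * (L / 4 * (n / 4 * δ ^ 2)) * (m * s) = ε * (T ^ 2 * (k * n) / 16) := by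
      calc _ = k * n * L / 16 * (δ ^ 2 * (m * s)) := by ring
        _ = k * n / 16 * (L * R ^ 2) := by rw [hδ2]; ring
        _ = _ := by rw [← hT2]; ring
    rw [h1]
    exact mul_lt_mul_of_pos_left (by linarith) hε

end DecOpt

theorem theorem2 :
    ∃ c c₀ c₁ c₂ : ℝ, 0 < c ∧ 0 < c₀ ∧ 0 < c₁ ∧ 0 < c₂ ∧
    ∀ η : ℝ, 0 < η → η ≤ 1 →
    -- the network, with a gossip matrix of eigengap `η`
    ∃ (m : ℕ) (G : SimpleGraph (Fin m)) (W : Matrix (Fin m) (Fin m) ℝ),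
      G.Connected ∧ DecOpt.IsGossipMatrix G W ∧ DecOpt.HasEigengap W η ∧
    ∀ (L R τ ε : ℝ) (d : ℕ), 0 < L → 0 < R → 0 < τ → 0 < ε → ε ≤ c₀ * (L * R ^ 2) →
      Real.sqrt (L * R ^ 2 / ε) ≤ ((d : ℝ) - 1) / 2 →
    -- the local cost functions and a solution at distance `R` from the starting point
    ∃ (f : Fin m → EuclideanSpace ℝ (Fin d) → ℝ) (xstar : EuclideanSpace ℝ (Fin d)),
      (∀ i, DecOpt.IsConvexSmooth L (f i)) ∧
      IsMinOn (DecOpt.objective f) Set.univ xstar ∧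
      DecOpt.frobNorm (fun _ : Fin m => (0 : EuclideanSpace ℝ (Fin d)) - xstar) = R ∧
      -- the two forms of the bound are equivalent
      c₁ * Real.sqrt (L * R ^ 2 / ε) ≤
        R * DecOpt.frobNorm (fun i => gradient (f i) xstar) / ε ∧
      R * DecOpt.frobNorm (fun i => gradient (f i) xstar) / ε ≤
        c₂ * Real.sqrt (L * R ^ 2 / ε) ∧
      -- the time needed by any method, in the function-error and in the Bregman metric
      ∀ x : ℝ → Fin m → EuclideanSpace ℝ (Fin d), DecOpt.IsFirstOrderTrajectory G τ f x →
        ∀ t : ℝ, 0 ≤ t →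
          (DecOpt.fem f (x t) ≤ ε ∨ DecOpt.bregman f xstar (x t) ≤ ε) →
          c * ((1 + τ / Real.sqrt η) * (Real.sqrt (L * R ^ 2 / ε) +
            R * DecOpt.frobNorm (fun i => gradient (f i) xstar) / ε)) ≤ t := by
  refine ⟨1 / 40000, 1 / 4096, 1, 32, by norm_num, by norm_num, by norm_num, by norm_num, ?_⟩
  intro η hη hη1
  obtain ⟨m, hm3, hmη, W, hW, hgap⟩ := DecOpt.exists_isGossipMatrix_hasEigengap hη hη1
  refine ⟨m, DecOpt.pathSq m, W, DecOpt.pathSq_connected (by omega), hW, hgap, ?_⟩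
  intro L R τ ε d hL hR hτ hε hεL hd
  -- This is `m / 4` rounded up: each end holds a fixed fraction of the agents, while the ends stay
  -- at least `m / 8` hops apart.
  obtain ⟨k, hk⟩ : ∃ k, k = (m + 3) / 4 := ⟨_, rfl⟩
  have hk2 : 2 * k ≤ m := by omega
  have hm3' : (3 : ℝ) ≤ m := by exact_mod_cast hm3
  have hk2' : 2 * (k : ℝ) ≤ m := by exact_mod_cast hk2
  have hk4 : (m : ℝ) ≤ 4 * k := by exact_mod_cast (by omega : m ≤ 4 * k)
  have hk4' : 4 * (k : ℝ) ≤ m + 3 := by exact_mod_cast (by omega : 4 * k ≤ m + 3)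
  have hk0 : (0 : ℝ) < k := by linarith
  obtain ⟨T, hT⟩ : ∃ T, T = Real.sqrt (L * R ^ 2 / ε) := ⟨_, rfl⟩
  rw [← hT] at hd ⊢
  have hT2 : T ^ 2 * ε = L * R ^ 2 := by
    rw [hT, Real.sq_sqrt (by positivity)]
    field_simp
  -- Here `c₀ = 1 / 4096 = 1 / 64²` is used; it makes `K` below at least `1`.
  have hT64 : 64 ≤ T := by
    rw [hT]
    apply Real.le_sqrt_of_sq_le
    rw [le_div_iff₀ hε]
    linarith
  obtain ⟨K, hK⟩ : ∃ K, K = ⌊T / 64⌋₊ := ⟨_, rfl⟩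
  have hK1 : 1 ≤ K := by
    rw [hK, Nat.one_le_floor_iff, le_div_iff₀ (by norm_num)]
    linarith
  have hK1' : (1 : ℝ) ≤ K := by exact_mod_cast hK1
  have hKT : 64 * (K : ℝ) ≤ T := by
    have := Nat.floor_le (show 0 ≤ T / 64 by positivity)
    rw [← hK] at this
    linarith
  have hTK : T ≤ 128 * K := by
    have := Nat.lt_floor_add_one (T / 64)
    rw [← hK] at this
    linarith
  have hn : 4 * K ≤ d := by
    have : (4 * K : ℝ) ≤ d := by linarith
    exact_mod_cast this
  obtain ⟨n, hnK⟩ : ∃ n : ℝ, n = 4 * K := ⟨_, rfl⟩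
  obtain ⟨s, hs⟩ : ∃ s : ℝ, s = n * (n + 1) * (2 * n + 1) / 6 := ⟨_, rfl⟩
  have hn4 : 4 ≤ n := by linarith
  have hs0 : 0 < s := by rw [hs]; positivity
  -- Normalizes `m` stacked copies of the solution to Frobenius norm `R`.
  obtain ⟨δ, hδ⟩ : ∃ δ : ℝ, δ = Real.sqrt (R ^ 2 / (m * s)) := ⟨_, rfl⟩
  have hδ2 : δ ^ 2 * (m * s) = R ^ 2 := by
    rw [hδ, Real.sq_sqrt (by positivity)]
    field_simp
  let f := DecOpt.hardCost m d k (4 * K) L δ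
  let xstar := DecOpt.chainSol d (4 * K) δ
  obtain ⟨g, hg⟩ : ∃ g, g = DecOpt.frobNorm (fun i => gradient (f i) xstar) := ⟨_, rfl⟩
  have hg0 : 0 ≤ g := by rw [hg]; exact Real.sqrt_nonneg _
  have hg2 : g ^ 2 = L ^ 2 * δ ^ 2 * (k * n) / 2 := by
    rw [hg, DecOpt.frobNorm_gradient_hardCost hk2 hn, hnK]
    push_cast
    ring
  have hTn : 256 * n ^ 2 ≤ T ^ 2 := by
    rw [show 256 * n ^ 2 = (16 * n) ^ 2 by ring]
    exact pow_le_pow_left₀ (by linarith) (by linarith) 2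
  have hnT : T ^ 2 ≤ 1024 * n ^ 2 := by
    rw [show 1024 * n ^ 2 = (32 * n) ^ 2 by ring]
    exact pow_le_pow_left₀ (by linarith) (by linarith) 2
  obtain ⟨hlow, hupp, hfar⟩ := DecOpt.hard_instance_estimates hk0 hk2' hk4 hn4 hs (by linarith)
    hTn hnT hε hR hT2 hδ2 hg0 hg2
  rw [hnK, mul_div_cancel_left₀ (K : ℝ) (four_ne_zero)] at hfar
  refine ⟨f, xstar, fun i => ?_, DecOpt.isMinOn_objective_hardCost hL.le hk2 hn, ?_, ?_, ?_, ?_⟩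
  · obtain ⟨r, hr⟩ := DecOpt.agentLinks_subset m k (4 * K) i
    exact DecOpt.isConvexSmooth_chainCost hL.le hr
  · simp only [DecOpt.frobNorm, zero_sub, norm_neg, Finset.sum_const, Finset.card_univ,
      Fintype.card_fin, nsmul_eq_mul, xstar]
    rw [DecOpt.norm_sq_chainSol δ hn, Real.sqrt_eq_iff_mul_self_eq (by positivity) hR.le, ← sq,
      ← hδ2, hs, hnK]
    push_cast
    ring
  · rw [← hg, one_mul]
    exact hlow
  · rw [← hg]
    exact hupp
  · intro x hx t ht hmet
    rw [← hg]
    obtain ⟨D, hD⟩ : ∃ D : ℝ, D = ((m : ℝ) + 1 - 2 * k) / 2 := ⟨_, rfl⟩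
    have hlate : K * (1 + τ * D) ≤ t := by
      by_contra hcon
      push Not at hcon
      have hmem : ∀ i, x t i ∈ DecOpt.coordsBelow d K :=
        DecOpt.mem_coordsBelow_of_le hk2 hτ hx ht (by rw [← hD]; exact hcon.le)
      refine absurd hfar (not_lt.2 ?_)
      rcases hmet with h | h
      · exact (DecOpt.bregman_hardCost_ge hL.le (by omega) hn fun _ => hmem ⟨0, by omega⟩).trans
          ((DecOpt.bregman_le_fem_hardCost hL.le hk2 hn (x t) ⟨0, by omega⟩).trans h)
      · exact (DecOpt.bregman_hardCost_ge hL.le (by omega) hn hmem).trans h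
    have hsqrt : τ / Real.sqrt η ≤ 8 * (τ * D) := by
      have h1 : 0 < Real.sqrt η := Real.sqrt_pos.2 hη
      have h2 : 1 ≤ Real.sqrt η * m := by
        rw [← Real.sqrt_sq (show (0 : ℝ) ≤ m by positivity), ← Real.sqrt_mul hη.le]
        exact Real.one_le_sqrt.2 hmη
      rw [div_le_iff₀ h1]
      have h3 : (m : ℝ) ≤ 8 * D := by rw [hD]; linarith
      calc τ = τ * 1 := (mul_one _).symm
        _ ≤ τ * (Real.sqrt η * (8 * D)) :=
          mul_le_mul_of_nonneg_left (h2.trans (mul_le_mul_of_nonneg_left h3 h1.le)) hτ.le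
        _ = _ := by ring
    have hτD : 0 ≤ τ * D := by
      have := div_nonneg hτ.le (Real.sqrt_nonneg η)
      linarith
    refine le_trans ?_ hlate
    -- Here `33 = 1 + c₂` and `T ≤ 128 K`. The product `8 * 33 * 128 = 33792` is below `40000 = 1 /
    -- c`.
    have h1 : (1 + τ / Real.sqrt η) * (T + R * g / ε) ≤ (8 * (1 + τ * D)) * (33 * (128 * K)) :=
      mul_le_mul (by linarith) (by linarith) (by positivity) (by positivity)
    have h2 : 0 ≤ K * (1 + τ * D) := by positivity
    linarith
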